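/- Setting. Let $G$ be a Lie group with semisimple Lie algebra $\mathfrak g=\mathfrak g_{-m}\oplus\dots\oplus\mathfrak g_m$, $|m|$-graded by a grading element $E$. Put $\mathfrak p=\mathfrak g_0\oplus\dots\oplus\mathfrak g_m$ and $\mathfrak p_+=\mathfrak g_1\oplus\dots\oplus\mathfrak g_m\cong(\mathfrak g/\mathfrak p)^*$ (via the Killing form), and let $P\subset G$ be a parabolic subgroup with Lie algebra $\mathfrak p$. Let $K$ be a Lie group and $H\subset K$ a closed subgroup, with Lie algebras $\mathfrak k\supset\mathfrak h$. Let $(\alpha,i)$ be a regular normal extension of $(K,H)$ to $(G,P)$: $i:H\to P$ is an injective Lie group homomorphism, $\alpha:\mathfrak k\to\mathfrak g$ is linear, $\alpha\circ\mathrm{Ad}(h)=\mathrm{Ad}(i(h))\circ\alpha$ for $h\in H$, $\alpha|_{\mathfrak h}=di$, $\alpha$ induces an isomorphism $\mathfrak k/\mathfrak h\cong\mathfrak g/\mathfrak p$, and the curvature $\kappa\in\wedge^2(\mathfrak g/\mathfrak p)^*\otimes\mathfrak g$ given by $$\kappa(\alpha(X)+\mathfrak p,\alpha(Y)+\mathfrak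 p)=[\alpha(X),\alpha(Y)]-\alpha([X,Y])$$ has homogeneity $\ge 1$ and satisfies $\partial^*\kappa=0$. Here $\partial^*$ is Kostant's codifferential, on two-forms given by $$(\partial^*\phi)(X)=2\sum_i Z_i\cdot\phi(X,X_i)-\sum_i\phi([Z_i,X],X_i),$$ where the $X_i\in\mathfrak g$ represent a basis of $\mathfrak g/\mathfrak p$ and the $Z_i\in\mathfrak p_+$ form the dual basis. Let $V$ be a finite-dimensional representation $\lambda$ of $P$ such that $d\lambda$ is the restriction to $\mathfrak p$ of a representation $\rho$ of $\mathfrak g$. For an $H$-equivariant linear map $\Phi:\mathfrak k\to\mathfrak{gl}(V)$ with $\Phi|_{\mathfrak h}=d\lambda\circ\alpha|_{\mathfrak h}$ let $\nabla^\Phi$ be the $K$-invariant linear connection on $K\times_{\lambda\circ i(H)}V\to K/H$ which on $H$-equivariant functions $s:K\to V$ is $\nabla^\Phi_Xs=X\cdot s+\Phi(X)s$ for $X\in\mathfrak k$ (derivative along the left-invariant vector field plus $\Phi$). Its curvature is $R^\Phi(X,Y)=[\Phi(X),\Phi(Y)]-\Phi([X,Y])$. The tractor connection is $\nabla^{\rho\circ\alpha}$.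 Let $\psi\in(\mathfrak k^*\otimes\mathfrak{gl}(V))^1$ be $H$-invariant and vanish on $\mathfrak h$. The prolongation connection constructed from $\psi$ is $\nabla^{\rho\circ\alpha+\Psi}$, where the correction $\Psi\in(\mathfrak k^*\otimes\mathfrak{gl}(V))^1$ is $H$-invariant, vanishes on $\mathfrak h$, satisfies $\partial^*\circ R^{\rho\circ\alpha+\Psi}(s)=0$ for all $s\in V$, and is obtained from $\Psi_0=\psi$ by finitely many steps $$\Psi_k=\Psi_{k-1}-\tfrac1{a_k}(\partial^*\otimes\mathrm{id}_{V^*})R^{\rho\circ\alpha+\Psi_{k-1}}$$ with constants $a_k\neq0$. Proposition. Take $\psi=0$ and suppose that $$\sum_i\rho(\kappa(X,X_i))(\rho(Z_i)s)=0\qquad\text{for all }X\in\mathfrak g,\ s\in V.$$ Then $\Psi=0$: the zero map is a correction constructed from $\psi=0$, and (whatever the choice of the constants $a_k$) it is the only one. Consequently the prolongation connection constructed from $\psi=0$ is the tractor connection $\nabla^{\rho\circ\alpha}$. -/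

import Mathlib

open scoped Manifold ContDiff

-- `Module.End ℝ V = 𝔤𝔩(V)` carries the commutator bracket.
attribute [local instance] LieRing.ofAssociativeRing

noncomputable section

namespace BGG

/-! ### Gradings, filtrations and dual bases -/

section Algebra

variable {𝔨 𝔤 V ι : Type*} [LieRing 𝔨] [LieAlgebra ℝ 𝔨] [LieRing 𝔤] [LieAlgebra ℝ 𝔤]
  [AddCommGroup V] [Module ℝ V] [Fintype ι]

/-- The filtration by eigenvalues: the `r`-th component is the sum of the eigenspaces of `T` for
all (not necessarily integral) real eigenvalues `c ≥ r`. -/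
def eigenFiltration (T : Module.End ℝ V) (r : ℝ) : Submodule ℝ V :=
  ⨆ (c : ℝ) (_ : r ≤ c), T.eigenspace c

/-- The filtration component `𝔤^r` of `𝔤` determined by the grading element `E`. -/
abbrev filt (E : 𝔤) (r : ℝ) : Submodule ℝ 𝔤 := eigenFiltration (LieAlgebra.ad ℝ 𝔤 E) r

/-- The parabolic subalgebra `𝔭 = 𝔤_0 ⊕ ⋯ ⊕ 𝔤_k` (as a subspace). -/
abbrev parabolic (E : 𝔤) : Submodule ℝ 𝔤 := filt E 0

/-- The nilradical `𝔭₊ = 𝔤_1 ⊕ ⋯ ⊕ 𝔤_k` (as a subspace). -/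
abbrev nilradical (E : 𝔤) : Submodule ℝ 𝔤 := filt E 1

/-- `E` is the grading element of a `|k|`-grading `𝔤 = 𝔤_{-k} ⊕ ⋯ ⊕ 𝔤_k`, where
`𝔤_j = {X | [E, X] = j X}`. That `[𝔤_i, 𝔤_j] ⊆ 𝔤_{i+j}` and that the sum is direct is automatic;
the negative part is required to be generated by `𝔤_{-1}`, as usual. -/
structure IsGradingElement (k : ℕ) (E : 𝔤) : Prop where
  decomposition :
    ⨆ j ∈ Finset.Icc (-(k : ℤ)) (k : ℤ), (LieAlgebra.ad ℝ 𝔤 E).eigenspace (j : ℝ) = ⊤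
  generated :
    (LieSubalgebra.lieSpan ℝ 𝔤 ((LieAlgebra.ad ℝ 𝔤 E).eigenspace (-1) : Set 𝔤)).toSubmodule =
      ⨆ j ∈ Finset.Icc (-(k : ℤ)) (-1), (LieAlgebra.ad ℝ 𝔤 E).eigenspace (j : ℝ)

/-- The elements `X i` represent a basis of `𝔤/𝔭`, and the elements `Z i` of `𝔭₊ ≅ (𝔤/𝔭)^*`
(the identification being induced by the Killing form) form the dual basis. -/
structure IsDualBases (E : 𝔤) (X Z : ι → 𝔤) : Prop where
  linearIndependent : LinearIndependent ℝ fun i => (parabolic E).mkQ (X i)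
  span_eq_top : Submodule.span ℝ (Set.range fun i => (parabolic E).mkQ (X i)) = ⊤
  mem_nilradical : ∀ i, Z i ∈ nilradical E
  dual_self : ∀ i, killingForm ℝ 𝔤 (Z i) (X i) = 1
  dual_ne : ∀ i j, i ≠ j → killingForm ℝ 𝔤 (Z i) (X j) = 0

/-! ### Kostant's codifferential -/

/-- Kostant's codifferential `∂^*` from two-forms to one-forms on `𝔤/𝔭`, with values in a module `V`
on which `z ∈ 𝔤` acts by `τ z`:
`(∂^* φ)(x) = 2 ∑ i, Z_i · φ(x, X_i) - ∑ i, φ([Z_i, x], X_i)`.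
Forms on `𝔤/𝔭` are viewed as forms on `𝔤`. See `codifferential_wedge` for the formula on
decomposable elements of `⋀² 𝔭₊ ⊗ V`. -/
def codifferential (X Z : ι → 𝔤) (τ : 𝔤 → V → V) (φ : 𝔤 → 𝔤 → V) (x : 𝔤) : V :=
  (2 : ℝ) • ∑ i, τ (Z i) (φ x (X i)) - ∑ i, φ ⁅Z i, x⁆ (X i)

/-- The curvature `R^Φ(X, Y) = [Φ X, Φ Y] - Φ [X, Y]` of the invariant linear connection given by
`Φ : 𝔨 → 𝔤𝔩(V)`. -/
def connCurvature (Φ : 𝔨 →ₗ[ℝ] Module.End ℝ V) (X Y : 𝔨) : Module.End ℝ V :=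
  ⁅Φ X, Φ Y⁆ - Φ ⁅X, Y⁆

/-- `α : 𝔨 → 𝔤` induces an isomorphism `𝔨/𝔥 → 𝔤/𝔭`; here `𝔥` is given as a set. -/
structure InducesIso (E : 𝔤) (𝔥 : Set 𝔨) (α : 𝔨 →ₗ[ℝ] 𝔤) : Prop where
  mem_iff : ∀ Y, α Y ∈ parabolic E ↔ Y ∈ 𝔥
  surj : ∀ x, ∃ Y, α Y - x ∈ parabolic E

variable {E : 𝔤} {𝔥 : Set 𝔨} {α : 𝔨 →ₗ[ℝ] 𝔤}

/-- A representative in `𝔨` of the class in `𝔨/𝔥` that corresponds to the class of `x` in `𝔤/𝔭`. -/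
def lift (hα : InducesIso E 𝔥 α) (x : 𝔤) : 𝔨 := (hα.surj x).choose

/-- A form on `𝔨/𝔥` (that is, a form on `𝔨` which vanishes upon insertion of elements of `𝔥`, so that
the choice of representatives is irrelevant), viewed as a form on `𝔤/𝔭`. -/
def transport {W : Type*} (hα : InducesIso E 𝔥 α) (φ : 𝔨 → 𝔨 → W) (x y : 𝔤) : W :=
  φ (lift hα x) (lift hα y)

/-- The curvature `κ` of the geometry given by `α`:
`κ(α X + 𝔭, α Y + 𝔭) = [α X, α Y] - α [X, Y]`. -/
def curvature (hα : InducesIso E 𝔥 α) : 𝔤 → 𝔤 → 𝔤 :=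
  transport hα fun X Y => ⁅α X, α Y⁆ - α ⁅X, Y⁆

/-- Normality: `2 ∑ i, [Z_i, κ(x, X_i)] - ∑ i, κ([Z_i, x], X_i) = 0`, that is `∂^* κ = 0`. -/
def IsNormal (hα : InducesIso E 𝔥 α) (X Z : ι → 𝔤) : Prop :=
  ∀ x, codifferential X Z (fun z w => ⁅z, w⁆) (curvature hα) x = 0

/-- Regularity: `κ` has homogeneity at least one. -/
def IsRegular (hα : InducesIso E 𝔥 α) : Prop :=
  ∀ i j : ℤ, ∀ x ∈ filt E (i : ℝ), ∀ y ∈ filt E (j : ℝ), curvature hα x y ∈ filt E ((i : ℝ) + j + 1)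

/-- The map `ρ ∘ α : 𝔨 → 𝔤𝔩(V)` that defines the tractor connection. -/
def tractorMap (ρ : 𝔤 →ₗ⁅ℝ⁆ Module.End ℝ V) (α : 𝔨 →ₗ[ℝ] 𝔤) : 𝔨 →ₗ[ℝ] Module.End ℝ V :=
  (ρ : 𝔤 →ₗ[ℝ] Module.End ℝ V) ∘ₗ α

/-- `ψ ∈ (𝔨^* ⊗ 𝔤𝔩(V))^1`: for `Y` in the `j`-th filtration component of `𝔨` (pulled back along `α`),
`ψ(Y)` maps `V^ℓ` into `V^{ℓ+j+1}`. -/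
def HasHomogeneityOne (E : 𝔤) (α : 𝔨 →ₗ[ℝ] 𝔤) (ρ : 𝔤 →ₗ⁅ℝ⁆ Module.End ℝ V)
    (ψ : 𝔨 →ₗ[ℝ] Module.End ℝ V) : Prop :=
  ∀ (j : ℤ) (Y : 𝔨), α Y ∈ filt E (j : ℝ) → ∀ (ℓ : ℝ), ∀ v ∈ eigenFiltration (ρ E) ℓ,
    ψ Y v ∈ eigenFiltration (ρ E) (ℓ + j + 1)

/-- `(∂^* ⊗ id_{V^*}) R^{ρ ∘ α + Ψ}`, evaluated at `x ∈ 𝔤` and `s ∈ V`. -/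
def codiffCurvature (hα : InducesIso E 𝔥 α) (X Z : ι → 𝔤) (ρ : 𝔤 →ₗ⁅ℝ⁆ Module.End ℝ V)
    (Ψ : 𝔨 →ₗ[ℝ] Module.End ℝ V) (x : 𝔤) (s : V) : V :=
  codifferential X Z (fun z => ρ z)
    (fun y y' => transport hα (connCurvature (tractorMap ρ α + Ψ)) y y' s) x

/-- One step of the iterative construction of the prolongation connection:
`Ψ' = Ψ - (1/a) (∂^* ⊗ id_{V^*}) R^{ρ ∘ α + Ψ}` for some constant `a ≠ 0`. -/
def ProlongationStep (hα : InducesIso E 𝔥 α) (X Z : ι → 𝔤) (ρ : 𝔤 →ₗ⁅ℝ⁆ Module.End ℝ V)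
    (Ψ Ψ' : 𝔨 →ₗ[ℝ] Module.End ℝ V) : Prop :=
  ∃ a : ℝ, a ≠ 0 ∧ ∀ Y s, Ψ' Y s = Ψ Y s - a⁻¹ • codiffCurvature hα X Z ρ Ψ (α Y) s

end Algebra

section Wedge

variable {𝔤 V ι : Type*} [LieRing 𝔤] [LieAlgebra ℝ 𝔤]
  [AddCommGroup V] [Module ℝ V] [Fintype ι]

theorem killingForm_eq_zero {E x y : 𝔤} (hx : x ∈ nilradical E) (hy : y ∈ parabolic E) :
    killingForm ℝ 𝔤 x y = 0 := by
  have key : ∀ (c d : ℝ), 1 ≤ c → 0 ≤ d → ∀ u ∈ (LieAlgebra.ad ℝ 𝔤 E).eigenspace c,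
      ∀ w ∈ (LieAlgebra.ad ℝ 𝔤 E).eigenspace d, killingForm ℝ 𝔤 u w = 0 := by
    intro c d hc hd u hu w hw
    rw [Module.End.mem_eigenspace_iff, LieAlgebra.ad_apply] at hu hw
    have h1 := LieModule.traceForm_apply_lie_apply ℝ 𝔤 𝔤 u E w
    rw [← lie_skew, hu, hw] at h1
    simp only [map_neg, map_smul, LinearMap.neg_apply, LinearMap.smul_apply, smul_eq_mul] at h1
    have h2 : (c + d) * killingForm ℝ 𝔤 u w = 0 := by
      unfold killingForm
      linarith
    exact (mul_eq_zero.mp h2).resolve_left (by linarith)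
  have hsub : nilradical E ≤ LinearMap.ker ((killingForm ℝ 𝔤).flip y) := by
    refine iSup₂_le fun c hc u hu => ?_
    have hsub2 : parabolic E ≤ LinearMap.ker (killingForm ℝ 𝔤 u) :=
      iSup₂_le fun d hd w hw => key c d hc hd u hu w hw
    exact hsub2 hy
  exact hsub hx

theorem nilradical_expand [Module.Finite ℝ 𝔤] [LieAlgebra.IsKilling ℝ 𝔤] {E : 𝔤} {X Z : ι → 𝔤} (h : IsDualBases E X Z) {W : 𝔤}
    (hW : W ∈ nilradical E) : ∑ i, killingForm ℝ 𝔤 W (X i) • Z i = W := by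
  have hmem : ∑ i, killingForm ℝ 𝔤 W (X i) • Z i ∈ nilradical E :=
    Submodule.sum_mem _ fun i _ => Submodule.smul_mem _ _ (h.mem_nilradical i)
  refine sub_eq_zero.mp ?_
  set U := ∑ i, killingForm ℝ 𝔤 W (X i) • Z i - W with hU
  have hUn : U ∈ nilradical E := Submodule.sub_mem _ hmem hW
  have hUX : ∀ j, killingForm ℝ 𝔤 U (X j) = 0 := by
    intro j
    have hs : ∑ i, killingForm ℝ 𝔤 W (X i) * killingForm ℝ 𝔤 (Z i) (X j) =
        killingForm ℝ 𝔤 W (X j) := by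
      rw [Finset.sum_eq_single j (fun i _ hij => by rw [h.dual_ne i j hij, mul_zero])
        (fun hj => absurd (Finset.mem_univ j) hj), h.dual_self, mul_one]
    simp [hU, LinearMap.sum_apply, hs]
  have hker : killingForm ℝ 𝔤 U = 0 := by
    ext y
    have hle : parabolic E ≤ LinearMap.ker (killingForm ℝ 𝔤 U) :=
      fun w hw => killingForm_eq_zero hUn hw
    have hz : (parabolic E).liftQ (killingForm ℝ 𝔤 U) hle = 0 := by
      refine LinearMap.ext_on_range h.span_eq_top fun i => ?_
      simpa using hUX i
    simpa using LinearMap.congr_fun hz ((parabolic E).mkQ y)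
  have hbot := LieAlgebra.IsKilling.ker_killingForm_eq_bot ℝ 𝔤
  have : U ∈ LinearMap.ker (killingForm ℝ 𝔤) := hker
  rwa [hbot, Submodule.mem_bot] at this

/-- On the form represented by `z ∧ w ⊗ v` with `z, w ∈ 𝔭₊` the codifferential is given by
`∂^*(z ∧ w ⊗ v) = z ⊗ w·v - w ⊗ z·v - [z, w] ⊗ v`. Here `z ∈ 𝔭₊` is viewed as a one-form by means of
the Killing form, and `(θ ∧ η)(x, y) = (θ(x) η(y) - θ(y) η(x)) / 2`. -/
theorem codifferential_wedge [Module.Finite ℝ 𝔤] [LieAlgebra.IsKilling ℝ 𝔤] {E : 𝔤} {X Z : ι → 𝔤} (h : IsDualBases E X Z)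
    (τ : 𝔤 →ₗ[ℝ] Module.End ℝ V) {z w : 𝔤} (hz : z ∈ nilradical E) (hw : w ∈ nilradical E)
    (v : V) (x : 𝔤) :
    codifferential X Z (fun y => τ y)
        (fun x y => ((killingForm ℝ 𝔤 z x * killingForm ℝ 𝔤 w y
          - killingForm ℝ 𝔤 z y * killingForm ℝ 𝔤 w x) / 2) • v) x =
      killingForm ℝ 𝔤 z x • τ w v - killingForm ℝ 𝔤 w x • τ z v - killingForm ℝ 𝔤 ⁅z, w⁆ x • v := by
  have e1 : ∀ u ∈ nilradical E, ∑ i, killingForm ℝ 𝔤 u (X i) • τ (Z i) v = τ u v := by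
    intro u hu
    conv_rhs => rw [← nilradical_expand h hu]
    simp [LinearMap.sum_apply]
  have e2 : ∀ u ∈ nilradical E, ∀ t : 𝔤,
      ∑ i, killingForm ℝ 𝔤 u (X i) * killingForm ℝ 𝔤 t ⁅Z i, x⁆ = killingForm ℝ 𝔤 t ⁅u, x⁆ := by
    intro u hu t
    conv_rhs => rw [← nilradical_expand h hu]
    simp [sum_lie]
  have e3 : killingForm ℝ 𝔤 z ⁅w, x⁆ = killingForm ℝ 𝔤 ⁅z, w⁆ x :=
    (LieModule.traceForm_apply_lie_apply ℝ 𝔤 𝔤 z w x).symm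
  have e4 : killingForm ℝ 𝔤 w ⁅z, x⁆ = - killingForm ℝ 𝔤 ⁅z, w⁆ x := by
    have := (LieModule.traceForm_apply_lie_apply ℝ 𝔤 𝔤 w z x).symm
    rw [← lie_skew w z, map_neg, LinearMap.neg_apply] at this
    exact this
  have s1 : (2 : ℝ) • ∑ i, τ (Z i) (((killingForm ℝ 𝔤 z x * killingForm ℝ 𝔤 w (X i)
      - killingForm ℝ 𝔤 z (X i) * killingForm ℝ 𝔤 w x) / 2) • v) =
      killingForm ℝ 𝔤 z x • τ w v - killingForm ℝ 𝔤 w x • τ z v := by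
    rw [← e1 w hw, ← e1 z hz, Finset.smul_sum, Finset.smul_sum, Finset.smul_sum,
      ← Finset.sum_sub_distrib]
    refine Finset.sum_congr rfl fun i _ => ?_
    rw [map_smul, smul_smul, smul_smul, smul_smul, ← sub_smul]
    congr 1
    ring
  have s2 : ∑ i, ((killingForm ℝ 𝔤 z ⁅Z i, x⁆ * killingForm ℝ 𝔤 w (X i)
      - killingForm ℝ 𝔤 z (X i) * killingForm ℝ 𝔤 w ⁅Z i, x⁆) / 2) • v =
      killingForm ℝ 𝔤 ⁅z, w⁆ x • v := by
    rw [← Finset.sum_smul]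
    congr 1
    rw [← Finset.sum_div, Finset.sum_sub_distrib, e2 z hz w, e4,
      Finset.sum_congr rfl fun i _ => mul_comm (killingForm ℝ 𝔤 z ⁅Z i, x⁆) _, e2 w hw z, e3]
    ring
  unfold codifferential
  rw [s1, s2]

end Wedge

/-! ### Lie groups -/

section Group

variable {EK EG K G V : Type*}
  [NormedAddCommGroup EK] [NormedSpace ℝ EK] [CompleteSpace EK]
  [TopologicalSpace K] [ChartedSpace EK K] [Group K] [LieGroup 𝓘(ℝ, EK) ∞ K]
  [NormedAddCommGroup EG] [NormedSpace ℝ EG] [CompleteSpace EG]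
  [TopologicalSpace G] [ChartedSpace EG G] [Group G] [LieGroup 𝓘(ℝ, EG) ∞ G]
  [NormedAddCommGroup V] [NormedSpace ℝ V]

/-- A `C^∞` Lie group has the regularity that Mathlib needs for the bracket on its Lie algebra. -/
instance instLEInftyMinSmoothness : ENat.LEInfty (minSmoothness ℝ 3) :=
  ⟨by
    rw [minSmoothness_of_isRCLikeNormedField]
    exact ENat.LEInfty.out⟩

/-- The curve `c` starts at the unit element with velocity `Y`. -/
def HasVelocity (c : ℝ → K) (Y : GroupLieAlgebra 𝓘(ℝ, EK) K) : Prop :=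
  c 0 = 1 ∧ HasMFDerivAt 𝓘(ℝ, ℝ) 𝓘(ℝ, EK) c 0 (ContinuousLinearMap.toSpanSingleton ℝ (Y : EK))

variable (EK) in
/-- The Lie algebra `𝔥` of a closed subgroup `H`, as a set: the velocities of curves in `H` that
start at the unit element. -/
def subgroupLieAlgebra (H : Subgroup K) : Set (GroupLieAlgebra 𝓘(ℝ, EK) K) :=
  {Y | ∃ c : ℝ → H, HasVelocity (fun t => (c t : K)) Y}

/-- The adjoint action `Ad(g)`, the derivative of `x ↦ g x g⁻¹` at the unit element. -/
def Ad (g : K) (Y : GroupLieAlgebra 𝓘(ℝ, EK) K) : GroupLieAlgebra 𝓘(ℝ, EK) K :=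
  (mfderiv 𝓘(ℝ, EK) 𝓘(ℝ, EK) (fun x => g * x * g⁻¹) 1 Y : EK)

/-- The elements of `G` whose adjoint action preserves the filtration of `𝔤`. -/
def filtrationStabilizer (E : GroupLieAlgebra 𝓘(ℝ, EG) G) : Set G :=
  {g | ∀ (j : ℤ), ∀ x ∈ filt E (j : ℝ), Ad g x ∈ filt E (j : ℝ)}

/-- `P` is a parabolic subgroup of `G` with Lie algebra `𝔭`: it lies between the stabilizer of the
filtration and the identity component of that stabilizer. -/
def IsParabolicSubgroup (E : GroupLieAlgebra 𝓘(ℝ, EG) G) (P : Subgroup G) : Prop :=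
  (P : Set G) ⊆ filtrationStabilizer E ∧ connectedComponentIn (filtrationStabilizer E) 1 ⊆ (P : Set G)

/-- `(α, i)` is an extension of `(K, H)` to `(G, P)`. -/
structure IsExtension (E : GroupLieAlgebra 𝓘(ℝ, EG) G) (H : Subgroup K) (P : Subgroup G)
    (α : GroupLieAlgebra 𝓘(ℝ, EK) K →ₗ[ℝ] GroupLieAlgebra 𝓘(ℝ, EG) G) (i : H →* P) : Prop where
  injective : Function.Injective i
  continuous : Continuous i
  equivariant : ∀ (h : H) (Y : GroupLieAlgebra 𝓘(ℝ, EK) K), α (Ad (h : K) Y) = Ad (i h : G) (α Y)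
  /-- `α|_𝔥` is the derivative of `i`. -/
  deriv : ∀ (c : ℝ → H) (Y : GroupLieAlgebra 𝓘(ℝ, EK) K), HasVelocity (fun t => (c t : K)) Y →
    HasVelocity (fun t => (i (c t) : G)) (α Y)
  inducesIso : InducesIso E (subgroupLieAlgebra EK H) α

/-- The representation `lam` of `P` on `V` is continuous (hence smooth), and its derivative
is the restriction to `𝔭` of the representation `ρ` of `𝔤`. -/
structure IsTractorRep (P : Subgroup G) (lam : Representation ℝ P V)
    (ρ : GroupLieAlgebra 𝓘(ℝ, EG) G →ₗ⁅ℝ⁆ Module.End ℝ V) : Prop where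
  continuous : ∀ v, Continuous fun p : P => lam p v
  deriv : ∀ (c : ℝ → P) (x : GroupLieAlgebra 𝓘(ℝ, EG) G), HasVelocity (fun t => (c t : G)) x →
    ∀ v, HasDerivAt (fun t => lam (c t) v) (ρ x v) 0

section Connections

variable {ι : Type*} [Fintype ι] {H : Subgroup K} {P : Subgroup G}
  {E : GroupLieAlgebra 𝓘(ℝ, EG) G}
  {α : GroupLieAlgebra 𝓘(ℝ, EK) K →ₗ[ℝ] GroupLieAlgebra 𝓘(ℝ, EG) G} {i : H →* P}

variable (EK) in
/-- Sections of the bundle `K ×_{lam ∘ i(H)} V → K/H`: smooth functions `s : K → V` such that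
`s(k h) = lam(i(h))⁻¹ s(k)`. -/
structure BundleSection (i : H →* P) (lam : Representation ℝ P V) where
  toFun : K → V
  smooth : ContMDiff 𝓘(ℝ, EK) 𝓘(ℝ, V) ∞ toFun
  equivariant : ∀ (k : K) (h : H), toFun (k * h) = lam (i h)⁻¹ (toFun k)

/-- The operator `∇^Φ = D^𝔨 + Φ`, where `D^𝔨_Y s` is the derivative of `s` along the left-invariant
vector field on `K` given by `Y ∈ 𝔨`. -/
def connection (i : H →* P) (lam : Representation ℝ P V)
    (Φ : GroupLieAlgebra 𝓘(ℝ, EK) K →ₗ[ℝ] Module.End ℝ V)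
    (s : BundleSection EK i lam) (k : K) (Y : GroupLieAlgebra 𝓘(ℝ, EK) K) : V :=
  let Ds : V := mfderiv 𝓘(ℝ, EK) 𝓘(ℝ, V) s.toFun k (mulInvariantVectorField Y k)
  Ds + Φ Y (s.toFun k)

/-- `ψ ∈ (𝔨^* ⊗ 𝔤𝔩(V))^1` is `H`-invariant and vanishes on `𝔥`, so that the invariant linear
connection given by `ρ ∘ α + ψ` is compressable. -/
structure IsCompressable (E : GroupLieAlgebra 𝓘(ℝ, EG) G)
    (α : GroupLieAlgebra 𝓘(ℝ, EK) K →ₗ[ℝ] GroupLieAlgebra 𝓘(ℝ, EG) G) (i : H →* P)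
    (lam : Representation ℝ P V) (ρ : GroupLieAlgebra 𝓘(ℝ, EG) G →ₗ⁅ℝ⁆ Module.End ℝ V)
    (ψ : GroupLieAlgebra 𝓘(ℝ, EK) K →ₗ[ℝ] Module.End ℝ V) : Prop where
  homogeneity : HasHomogeneityOne E α ρ ψ
  vanishes : ∀ Y ∈ subgroupLieAlgebra EK H, ψ Y = 0
  invariant : ∀ (h : H) Y v, ψ (Ad (h : K) Y) (lam (i h) v) = lam (i h) (ψ Y v)

/-- `Ψ` is the correction that defines the prolongation connection, constructed from the initial
map `ψ`: it is compressable, satisfies `∂^* ∘ R^{ρ ∘ α + Ψ} = 0`, and is obtained from `ψ` by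
finitely many steps `Ψ_k = Ψ_{k-1} - (1/a_k) (∂^* ⊗ id_{V^*}) R^{ρ ∘ α + Ψ_{k-1}}`. -/
structure IsProlongationCorrection (hα : IsExtension E H P α i)
    (X Z : ι → GroupLieAlgebra 𝓘(ℝ, EG) G) (lam : Representation ℝ P V)
    (ρ : GroupLieAlgebra 𝓘(ℝ, EG) G →ₗ⁅ℝ⁆ Module.End ℝ V)
    (ψ Ψ : GroupLieAlgebra 𝓘(ℝ, EK) K →ₗ[ℝ] Module.End ℝ V) : Prop where
  compressable : IsCompressable E α i lam ρ Ψ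
  normalized : ∀ x s, codiffCurvature hα.inducesIso X Z ρ Ψ x s = 0
  reachable : Relation.ReflTransGen (ProlongationStep hα.inducesIso X Z ρ) ψ Ψ

/-- The operator `nabla` is the prolongation connection `∇^{ρ ∘ α + Ψ}` constructed from `ψ`. -/
def IsProlongationConnection (hα : IsExtension E H P α i)
    (X Z : ι → GroupLieAlgebra 𝓘(ℝ, EG) G) (lam : Representation ℝ P V)
    (ρ : GroupLieAlgebra 𝓘(ℝ, EG) G →ₗ⁅ℝ⁆ Module.End ℝ V)
    (ψ : GroupLieAlgebra 𝓘(ℝ, EK) K →ₗ[ℝ] Module.End ℝ V)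
    (nabla : BundleSection EK i lam → K → GroupLieAlgebra 𝓘(ℝ, EK) K → V) : Prop :=
  ∃ Ψ, IsProlongationCorrection hα X Z lam ρ ψ Ψ ∧
    nabla = connection i lam (tractorMap ρ α + Ψ)

/-- The tractor connection `∇^{ρ ∘ α}`. -/
def tractorConnection (i : H →* P) (lam : Representation ℝ P V)
    (ρ : GroupLieAlgebra 𝓘(ℝ, EG) G →ₗ⁅ℝ⁆ Module.End ℝ V)
    (α : GroupLieAlgebra 𝓘(ℝ, EK) K →ₗ[ℝ] GroupLieAlgebra 𝓘(ℝ, EG) G) :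
    BundleSection EK i lam → K → GroupLieAlgebra 𝓘(ℝ, EK) K → V :=
  connection i lam (tractorMap ρ α)

end Connections

end Group

end BGG

end

namespace BGG

section Prolongation

variable {𝔨 𝔤 V ι : Type*} [LieRing 𝔨] [LieAlgebra ℝ 𝔨] [LieRing 𝔤] [LieAlgebra ℝ 𝔤]
  [AddCommGroup V] [Module ℝ V] [Fintype ι] {E : 𝔤} {𝔥 : Set 𝔨} {α : 𝔨 →ₗ[ℝ] 𝔤}

/-! Since `ρ` preserves brackets, the tractor connection has curvature `ρ ∘ κ`. In the
codifferential of the form `ρ(κ(·,·))s`, with values in `V`, the elements `Z_i` act from the left on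
`V`, whereas in `∂^* κ` they act on `𝔤` by the bracket. The two differ by a commutator: `ρ(Z)ρ(W) =
ρ([Z, W]) + ρ(W)ρ(Z)`. Hence `∂^*(R s) = ρ(∂^* κ)s + 2 ∑ i, ρ(κ(x, X_i))ρ(Z_i)s` at `x`. The first
term vanishes by normality, the second by the assumption on `κ`. So `0` is already normalized. Each
step of the iteration subtracts a multiple of `∂^* R`, which is zero at `Ψ = 0`, so the iteration
never leaves `0`, whatever the constants are. This gives uniqueness; existence is the chain of
length zero, because the zero map is trivially compressable. -/

/-- The curvature of the tractor connection is `ρ ∘ κ`. -/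
theorem transport_connCurvature_tractorMap (hα : InducesIso E 𝔥 α)
    (ρ : 𝔤 →ₗ⁅ℝ⁆ Module.End ℝ V) (x y : 𝔤) :
    transport hα (connCurvature (tractorMap ρ α)) x y = ρ (curvature hα x y) := by
  -- Both sides are evaluated on the same chosen lifts to `𝔨`, so independence of the
  -- representatives plays no role here.
  simp [transport, connCurvature, tractorMap, curvature]

/-- Applying `ρ` to the codifferential of a `𝔤`-valued form `φ` gives the codifferential of `ρ ∘ φ`,
up to the term `2 ∑ i, ρ(φ(x, X_i)) ∘ ρ(Z_i)`. -/
theorem codifferential_rep (X Z : ι → 𝔤) (ρ : 𝔤 →ₗ⁅ℝ⁆ Module.End ℝ V) (φ : 𝔤 → 𝔤 → 𝔤)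
    (x : 𝔤) (s : V) :
    codifferential X Z (fun z => ρ z) (fun y y' => ρ (φ y y') s) x =
      ρ (codifferential X Z (fun z w => ⁅z, w⁆) φ x) s
        + (2 : ℝ) • ∑ i, ρ (φ x (X i)) (ρ (Z i) s) := by
  -- Moving `ρ(Z_i)` past `ρ(φ(x, X_i))` produces the adjoint action on values and the extra term.
  -- The second sum in the codifferential involves no action on values, so it commutes with `ρ`
  -- directly.
  have h : ∀ i, ρ (Z i) (ρ (φ x (X i)) s) =
      ρ ⁅Z i, φ x (X i)⁆ s + ρ (φ x (X i)) (ρ (Z i) s) := fun i => by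
    simp [LieHom.map_lie, LieRing.of_associative_ring_bracket]
  simp only [codifferential, h, Finset.sum_add_distrib, smul_add, map_sub, map_smul, map_sum,
    LinearMap.sub_apply, LinearMap.smul_apply, LinearMap.sum_apply]
  abel

/-- If `κ` is normal and `∑ i, ρ(κ(x, X_i)) ∘ ρ(Z_i) = 0`, then the curvature of the tractor
connection is annihilated by `∂^* ⊗ id_{V^*}`. -/
theorem codiffCurvature_zero (hα : InducesIso E 𝔥 α) {X Z : ι → 𝔤} (hnorm : IsNormal hα X Z)
    (ρ : 𝔤 →ₗ⁅ℝ⁆ Module.End ℝ V)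
    (hκ : ∀ x s, ∑ j, ρ (curvature hα x (X j)) (ρ (Z j) s) = 0) (x : 𝔤) (s : V) :
    codiffCurvature hα X Z ρ 0 x s = 0 := by
  simp only [codiffCurvature, add_zero, transport_connCurvature_tractorMap]
  -- Normality removes `ρ(∂^* κ)`, and the curvature condition removes the commutator remainder.
  rw [codifferential_rep, hnorm x, hκ]
  simp

/-- If the tractor connection is normalized, the iterative construction starting from `0` is
stationary. -/
theorem eq_zero_of_reflTransGen (hα : InducesIso E 𝔥 α) {X Z : ι → 𝔤}
    {ρ : 𝔤 →ₗ⁅ℝ⁆ Module.End ℝ V} (h0 : ∀ x s, codiffCurvature hα X Z ρ 0 x s = 0)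
    {Ψ : 𝔨 →ₗ[ℝ] Module.End ℝ V}
    (h : Relation.ReflTransGen (ProlongationStep hα X Z ρ) 0 Ψ) : Ψ = 0 := by
  induction h with
  | refl => rfl
  | tail _ hstep ih =>
    -- By induction the previous iterate is `0`, exactly where `h0` applies; the value of `a` is
    -- then irrelevant.
    subst ih
    obtain ⟨a, -, h⟩ := hstep
    ext Y s
    simp [h, h0]

theorem hasHomogeneityOne_zero (E : 𝔤) (α : 𝔨 →ₗ[ℝ] 𝔤) (ρ : 𝔤 →ₗ⁅ℝ⁆ Module.End ℝ V) :
    HasHomogeneityOne E α ρ 0 :=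
  fun _ _ _ _ _ _ => Submodule.zero_mem _

end Prolongation

end BGG

theorem mainTheorem2
    {EK EG K G V ι : Type*}
    -- the Lie groups `K` and `G`, with `G` semisimple
    [NormedAddCommGroup EK] [NormedSpace ℝ EK] [FiniteDimensional ℝ EK] [CompleteSpace EK]
    [TopologicalSpace K] [ChartedSpace EK K] [Group K] [LieGroup 𝓘(ℝ, EK) ∞ K]
    [NormedAddCommGroup EG] [NormedSpace ℝ EG] [FiniteDimensional ℝ EG] [CompleteSpace EG]
    [TopologicalSpace G] [ChartedSpace EG G] [Group G] [LieGroup 𝓘(ℝ, EG) ∞ G]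
    [LieAlgebra.IsSemisimple ℝ (GroupLieAlgebra 𝓘(ℝ, EG) G)]
    -- the `|m|`-grading and the parabolic subgroup `P`
    (m : ℕ) (E : GroupLieAlgebra 𝓘(ℝ, EG) G) (hE : BGG.IsGradingElement m E)
    (P : Subgroup G) (hP : BGG.IsParabolicSubgroup E P)
    -- the closed subgroup `H` and the regular normal extension `(α, i)`
    (H : Subgroup K) (hH : IsClosed (H : Set K))
    (α : GroupLieAlgebra 𝓘(ℝ, EK) K →ₗ[ℝ] GroupLieAlgebra 𝓘(ℝ, EG) G) (i : H →* P)
    (hα : BGG.IsExtension E H P α i)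
    [Fintype ι] (X Z : ι → GroupLieAlgebra 𝓘(ℝ, EG) G) (hXZ : BGG.IsDualBases E X Z)
    (hreg : BGG.IsRegular hα.inducesIso) (hnorm : BGG.IsNormal hα.inducesIso X Z)
    -- the representation that defines the tractor bundle
    [NormedAddCommGroup V] [NormedSpace ℝ V] [FiniteDimensional ℝ V]
    (lam : Representation ℝ P V) (ρ : GroupLieAlgebra 𝓘(ℝ, EG) G →ₗ⁅ℝ⁆ Module.End ℝ V)
    (hρ : BGG.IsTractorRep P lam ρ)
    -- the condition on the curvature
    (hκ : ∀ (x : GroupLieAlgebra 𝓘(ℝ, EG) G) (s : V),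
      ∑ j, ρ (BGG.curvature hα.inducesIso x (X j)) (ρ (Z j) s) = 0) :
    (∀ Ψ : GroupLieAlgebra 𝓘(ℝ, EK) K →ₗ[ℝ] Module.End ℝ V,
      BGG.IsProlongationCorrection hα X Z lam ρ 0 Ψ ↔ Ψ = 0) ∧
    ∀ nabla : BGG.BundleSection EK i lam → K → GroupLieAlgebra 𝓘(ℝ, EK) K → V,
      BGG.IsProlongationConnection hα X Z lam ρ 0 nabla ↔
        nabla = BGG.tractorConnection i lam ρ α := by
  have h0 := BGG.codiffCurvature_zero hα.inducesIso hnorm ρ hκ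
  have key : ∀ Ψ : GroupLieAlgebra 𝓘(ℝ, EK) K →ₗ[ℝ] Module.End ℝ V,
      BGG.IsProlongationCorrection hα X Z lam ρ 0 Ψ ↔ Ψ = 0 := by
    refine fun Ψ => ⟨fun h => BGG.eq_zero_of_reflTransGen hα.inducesIso h0 h.reachable, ?_⟩
    rintro rfl
    -- Invariance reduces to linearity of `lam (i h)`, and reachability holds with no steps at all.
    exact ⟨⟨BGG.hasHomogeneityOne_zero E α ρ, fun _ _ => rfl, fun _ _ _ => by simp⟩, h0, .refl⟩
  refine ⟨key, fun nabla => ?_⟩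
  -- By `key` the existential over corrections collapses to `Ψ = 0`.
  simp only [BGG.IsProlongationConnection, key, exists_eq_left, add_zero, BGG.tractorConnection]
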